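/- For $n\ge 1$ let $U_n$ be the uniform distribution on $[n]$, and let $d_{TV}(p,q)=\frac12\|p-q\|_1$ for distributions $p,q$ on $[n]$. A (randomized) algorithm $A:[n]^s\to\{\mathsf{accept},\mathsf{reject},\bot\}$ is $\xi$-differentially private if $\Pr[A(X)\in O]\le e^{\xi}\Pr[A(X')\in O]$ for every set $O$ of answers and all $X,X'\in[n]^s$ that differ in exactly one sample. Given a reference distribution $q$ and an advice distribution $\hat p$ on $[n]$, such an $A$ is a $\xi$-differentially private $(\alpha,\varepsilon,\delta)$-augmented identity tester for $q$ with advice $\hat p$, using $s$ samples, if it is $\xi$-differentially private and, for every distribution $p$ on $[n]$, on $s$ i.i.d. samples from $p$: (i) if $p=q$, it outputs $\mathsf{reject}$ with probability at most $\delta$; (ii) if $d_{TV}(p,q)>\varepsilon$, it outputs $\mathsf{accept}$ with probability at most $\delta$; (iii) if $d_{TV}(p,\hat p)\le\alpha$, it outputs $\bot$ with probability at most $\delta$. **Theorem.** There is an absolute constant $c>0$ such that the following holds for every $n\ge1$ and every $\eta\in[0,1-\frac1n]$ (the range of possible values of $d_{TV}(U_n,\cdot)$). There is an advice distribution $\hat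 p$ on $[n]$ with $d_{TV}(U_n,\hat p)=\eta$ such that, for all $\varepsilon,\alpha\in[0,\frac12)$ with $\alpha<\eta$, all $\xi>0$ and all $s$, every $\xi$-differentially private $(\alpha,\varepsilon,0.2)$-augmented identity tester for $q=U_n$ with advice $\hat p$ that uses $s$ samples satisfies $$ s\;\ge\; c\cdot\min\left(\frac{1}{(\eta-\alpha)^2}+\frac{1}{\xi(\eta-\alpha)},\ \frac{\sqrt n}{\varepsilon^2}+\frac{n^{1/3}}{\varepsilon^{4/3}\xi^{2/3}}+\frac{\sqrt n}{\varepsilon\sqrt\xi}+\frac{1}{\varepsilon\xi}\right), $$ where for $\varepsilon=0$ the second argument of the minimum is $+\infty$. -/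

import Mathlib

noncomputable section

namespace AugTest

/-- The three possible answers of an augmented tester; `bot` stands for `⊥`. -/
inductive Answer where
  | accept
  | reject
  | bot
  deriving DecidableEq

instance : Fintype Answer where
  elems := {Answer.accept, Answer.reject, Answer.bot}
  complete := by intro a; cases a <;> simp

/-- Probability distributions on a finite type, as probability mass functions. -/
abbrev Distr (X : Type) [Fintype X] : Type := stdSimplex ℝ X

/-- The uniform distribution on `[n]`, every element having probability `1 / n`. -/
abbrev uniform (n : ℕ) [NeZero n] : Distr (Fin n) := stdSimplex.barycenter

/-- Total variation distance (half of the `ℓ₁` distance). -/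
def tvDist {X : Type} [Fintype X] (p q : Distr X) : ℝ :=
  (1 / 2) * ∑ i, |p i - q i|

/-- `p` is `ε`-far from the property `P`. -/
def IsFar {X : Type} [Fintype X] (ε : ℝ) (p : Distr X) (P : Set (Distr X)) : Prop :=
  ∀ q ∈ P, ε < tvDist p q

/-- A randomized algorithm that takes a dataset of `s` elements of `[n]` and returns an answer:
each dataset is mapped to the distribution of the random answer. -/
abbrev Algorithm (n s : ℕ) : Type := (Fin s → Fin n) → Distr Answer

/-- Pure `ξ`-differential privacy: the datasets `x` and `y` differ in exactly one sample. -/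
def IsDP {n s : ℕ} (ξ : ℝ) (A : Algorithm n s) : Prop :=
  ∀ x y : Fin s → Fin n, hammingDist x y = 1 →
    ∀ O : Finset Answer, ∑ a ∈ O, A x a ≤ Real.exp ξ * ∑ a ∈ O, A y a

/-- The probability that `A` answers `a` on `s` independent samples from `p`. -/
def answerProb {n s : ℕ} (A : Algorithm n s) (p : Distr (Fin n)) (a : Answer) : ℝ :=
  ∑ x : Fin s → Fin n, (∏ j, p (x j)) * A x a

/-- `A` is a `(ξ, ε, α, δ)`-private augmented tester, with advice `phat`, for the property `P`. -/
structure IsPrivateAugmentedTester {n s : ℕ} (ξ ε α δ : ℝ) (P : Set (Distr (Fin n)))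
    (phat : Distr (Fin n)) (A : Algorithm n s) : Prop where
  isDP : IsDP ξ A
  reject_le : ∀ p : Distr (Fin n), p ∈ P → answerProb A p Answer.reject ≤ δ
  accept_le : ∀ p : Distr (Fin n), IsFar ε p P → answerProb A p Answer.accept ≤ δ
  bot_le : ∀ p : Distr (Fin n), tvDist p phat ≤ α → answerProb A p Answer.bot ≤ δ

/-- Private augmented identity testing with reference distribution `q`: the property is `{q}`. -/
def IsPrivateAugmentedIdentityTester {n s : ℕ} (ξ ε α δ : ℝ) (q phat : Distr (Fin n))
    (A : Algorithm n s) : Prop :=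
  IsPrivateAugmentedTester ξ ε α δ {q} phat A

/-- `1 / g² + 1 / (ξ g)`, to be used with `g = η - α`. -/
def adviceRate (g ξ : ℝ) : ℝ :=
  1 / g ^ 2 + 1 / (ξ * g)

/-- `√n / ε² + n^{1/3} / (ε^{4/3} ξ^{2/3}) + √n / (ε √ξ) + 1 / (ε ξ)`. -/
def identityRate (n : ℕ) (ε ξ : ℝ) : ℝ :=
  √(n : ℝ) / ε ^ 2
    + (n : ℝ) ^ (1 / 3 : ℝ) / (ε ^ (4 / 3 : ℝ) * ξ ^ (2 / 3 : ℝ))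
    + √(n : ℝ) / (ε * √ξ)
    + 1 / (ε * ξ)

/-- The minimum of the two rates. At `ε = 0` the second one is infinite, so that the minimum is
the first one. -/
def augmentedRate (n : ℕ) (ε α η ξ : ℝ) : ℝ :=
  if ε = 0 then adviceRate (η - α) ξ
  else min (adviceRate (η - α) ξ) (identityRate n ε ξ)

end AugTest

end

/-! On uniform samples the tester rejects with probability at most 1/5, so it either answers `bot`
with probability at least 9/20 or accepts with probability at least 7/20. Each case gives one of the
two rates, because an answer probability, seen as a function `f` of the dataset, has to separate
`uniform` from other sources. Privacy makes `f` Lipschitz of constant `2ξ` for the Hamming distance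
(when `ξ ≤ 1`). Many `bot` answers: the point of the segment from `uniform` to the advice at
distance `α` from the advice must get few of them, yet it is only `η - α` away from `uniform`. The
advice is chosen with `χ²` divergence `O(η²)`, so `χ²` gives `1/(η-α)²`, and changing samples one at
a time gives `1/(ξ(η-α))` (`adviceRate_le_of_gap`). Many acceptances: all `ε`-far sources must get
few of them. A single one gives `1/(εξ)`. The other terms come from a random perturbation,
independent and centred in each block of four elements. The second moment method gives `√n/ε²`
(`le_sq_of_mixture_gap`). For Lipschitz `f`, the blocks are perturbed one after another; centring
kills the first-order effect of each block, and the second-order effect is bounded in two ways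
(`mixture_gap_le`), which give `√n/(ε√ξ)` and `n^{1/3}/(ε^{4/3}ξ^{2/3})`. -/

namespace AugTest

open Finset Function

/-! ### Product distributions: Lipschitz and `χ²` comparison. -/

section IidSum

variable {X : Type} {s : ℕ}

/-- Changing one coordinate of the argument changes the value of `f` by at most `L`. -/
def HamLip (L : ℝ) (f : (Fin s → X) → ℝ) : Prop :=
  ∀ (x : Fin s → X) (j : Fin s) (a : X), |f (update x j a) - f x| ≤ L

theorem HamLip.cons {L : ℝ} {f : (Fin (s + 1) → X) → ℝ} (hf : HamLip L f) (a : X) :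
    HamLip L (fun x : Fin s → X => f (Fin.cons a x)) := fun x j b => by
  have := hf (Fin.cons a x) j.succ b
  rwa [← Fin.cons_update] at this

theorem HamLip.abs_cons_sub_cons {L : ℝ} {f : (Fin (s + 1) → X) → ℝ} (hf : HamLip L f)
    (x : Fin s → X) (a b : X) : |f (Fin.cons a x) - f (Fin.cons b x)| ≤ L := by
  have := hf (Fin.cons b x) 0 a
  rwa [Fin.update_cons_zero] at this

theorem hamLip_of_abs_le {M : ℝ} {f : (Fin s → X) → ℝ} (h : ∀ x, |f x| ≤ M) :
    HamLip (2 * M) f := fun x j a => by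
  have h1 := abs_le.1 (h x)
  have h2 := abs_le.1 (h (update x j a))
  rw [abs_le]
  constructor <;> linarith

variable [Fintype X]

/-- The integral of `f` against the `s`-fold product of `p`. -/
def iidSum (p : X → ℝ) (f : (Fin s → X) → ℝ) : ℝ :=
  ∑ x : Fin s → X, (∏ j, p (x j)) * f x

theorem iidSum_length_zero (p : X → ℝ) (f : (Fin 0 → X) → ℝ) : iidSum p f = f Fin.elim0 := by
  simp only [iidSum, univ_unique, univ_eq_empty, prod_empty, one_mul, sum_singleton]
  exact congrArg f (Subsingleton.elim _ _)

theorem iidSum_succ (p : X → ℝ) (f : (Fin (s + 1) → X) → ℝ) :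
    iidSum p f = ∑ a, p a * iidSum p (fun x : Fin s → X => f (Fin.cons a x)) := by
  simp only [iidSum]
  rw [← (Fin.consEquiv (fun _ : Fin (s + 1) => X)).sum_comp, Fintype.sum_prod_type]
  refine sum_congr rfl fun a _ => ?_
  rw [mul_sum]
  refine sum_congr rfl fun x _ => ?_
  simp [Fin.consEquiv, Fin.prod_univ_succ, mul_assoc]

theorem sum_prod_eq_pow (p : X → ℝ) :
    ∑ x : Fin s → X, ∏ j, p (x j) = (∑ a, p a) ^ s :=
  (Fintype.sum_pow p s).symm

theorem iidSum_finset_sum {ι : Type*} (t : Finset ι) (p : X → ℝ) (c : ι → ℝ)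
    (f : ι → (Fin s → X) → ℝ) :
    iidSum p (fun x => ∑ i ∈ t, c i * f i x) = ∑ i ∈ t, c i * iidSum p (f i) := by
  simp only [iidSum, mul_sum]
  rw [sum_comm]
  exact sum_congr rfl fun i _ => sum_congr rfl fun x _ => by ring

theorem iidSum_sub (p : X → ℝ) (f g : (Fin s → X) → ℝ) :
    iidSum p (fun x => f x - g x) = iidSum p f - iidSum p g := by
  simp only [iidSum, mul_sub, sum_sub_distrib]

theorem iidSum_const {p : X → ℝ} (hp : p ∈ stdSimplex ℝ X) (c : ℝ) :
    iidSum p (fun _ : Fin s → X => c) = c := by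
  simp only [iidSum, ← sum_mul, sum_prod_eq_pow, hp.2, one_pow, one_mul]

theorem iidSum_mono {p : X → ℝ} (hp : p ∈ stdSimplex ℝ X) {f g : (Fin s → X) → ℝ}
    (h : ∀ x, f x ≤ g x) : iidSum p f ≤ iidSum p g :=
  sum_le_sum fun x _ => mul_le_mul_of_nonneg_left (h x) (prod_nonneg fun _ _ => hp.1 _)

theorem abs_iidSum_le {p : X → ℝ} (hp : p ∈ stdSimplex ℝ X) {f : (Fin s → X) → ℝ} {M : ℝ}
    (h : ∀ x, |f x| ≤ M) : |iidSum p f| ≤ M := by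
  rw [abs_le]
  constructor
  · simpa [iidSum_const hp] using
      iidSum_mono hp (f := fun _ => -M) (g := f) fun x => (abs_le.1 (h x)).1
  · simpa [iidSum_const hp] using
      iidSum_mono hp (f := f) (g := fun _ => M) fun x => (abs_le.1 (h x)).2

theorem abs_sum_mul_le_of_mem_stdSimplex {p : X → ℝ} (hp : p ∈ stdSimplex ℝ X) {g : X → ℝ} {M : ℝ}
    (h : ∀ x, |g x| ≤ M) : |∑ x, p x * g x| ≤ M := by
  calc |∑ x, p x * g x| ≤ ∑ x, p x * M :=
        (abs_sum_le_sum_abs _ _).trans (sum_le_sum fun x _ => by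
          rw [abs_mul, abs_of_nonneg (hp.1 x)]
          exact mul_le_mul_of_nonneg_left (h x) (hp.1 x))
    _ = M := by rw [← sum_mul, hp.2, one_mul]

theorem abs_sum_mul_le_of_sum_eq_zero {u g : X → ℝ} {L : ℝ} (hu : ∑ a, u a = 0)
    (h : ∀ a b, |g a - g b| ≤ L) : |∑ a, u a * g a| ≤ L * ∑ a, |u a| := by
  rcases isEmpty_or_nonempty X with hX | ⟨⟨b⟩⟩
  · simp
  · calc |∑ a, u a * g a| = |∑ a, u a * (g a - g b)| := by
          simp only [mul_sub, sum_sub_distrib, ← sum_mul, hu, zero_mul, sub_zero]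
      _ ≤ ∑ a, L * |u a| := (abs_sum_le_sum_abs _ _).trans (sum_le_sum fun a _ => by
          rw [abs_mul, mul_comm]
          exact mul_le_mul_of_nonneg_right (h a b) (abs_nonneg _))
      _ = L * ∑ a, |u a| := (mul_sum _ _ _).symm

/-- Hybrid argument: the samples are switched from `q` to `p` one at a time, and each switch costs
at most `L` times the `ℓ₁` distance. -/
theorem abs_iidSum_sub_iidSum_le_of_hamLip {p q : X → ℝ} (hp : p ∈ stdSimplex ℝ X)
    (hq : q ∈ stdSimplex ℝ X) {L : ℝ} {f : (Fin s → X) → ℝ} (hf : HamLip L f) :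
    |iidSum p f - iidSum q f| ≤ s * (L * ∑ a, |p a - q a|) := by
  induction s with
  | zero => simp [iidSum_length_zero]
  | succ s ih =>
    have key : iidSum p f - iidSum q f =
        ∑ a, (p a - q a) * iidSum p (fun x : Fin s → X => f (Fin.cons a x)) +
        ∑ a, q a * (iidSum p (fun x : Fin s → X => f (Fin.cons a x)) -
          iidSum q (fun x : Fin s → X => f (Fin.cons a x))) := by
      rw [iidSum_succ, iidSum_succ, ← sum_sub_distrib, ← sum_add_distrib]
      exact sum_congr rfl fun a _ => by ring
    have h1 : |∑ a, (p a - q a) * iidSum p (fun x : Fin s → X => f (Fin.cons a x))| ≤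
        L * ∑ a, |p a - q a| := by
      refine abs_sum_mul_le_of_sum_eq_zero (by rw [sum_sub_distrib, hp.2, hq.2, sub_self]) ?_
      intro a b
      rw [← iidSum_sub]
      exact abs_iidSum_le hp fun x => hf.abs_cons_sub_cons x a b
    have h2 := abs_sum_mul_le_of_mem_stdSimplex hq fun a => ih (hf.cons a)
    rw [key]
    refine (abs_add_le _ _).trans ((add_le_add h1 h2).trans (le_of_eq ?_))
    push_cast
    ring

/-- The second moment method: a mixture of product distributions is compared with a product
distribution through the `χ²` divergence. -/
theorem sq_sum_iidSum_sub_iidSum_le {Z : Type*} [Fintype Z] {ω : Z → ℝ} (hω : ω ∈ stdSimplex ℝ Z)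
    {q : Z → X → ℝ} (hq : ∀ z, q z ∈ stdSimplex ℝ X) {r : X → ℝ} (hr : r ∈ stdSimplex ℝ X)
    (hr0 : ∀ x, 0 < r x) {f : (Fin s → X) → ℝ} {M : ℝ} (hf : ∀ x, |f x| ≤ M) :
    (∑ z, ω z * iidSum (q z) f - iidSum r f) ^ 2 ≤
      (∑ z, ω z * ∑ z', ω z' * (∑ x, q z x * q z' x / r x) ^ s - 1) * M ^ 2 := by
  set R : (Fin s → X) → ℝ := fun x => ∏ j, r (x j) with hR
  set Q : (Fin s → X) → ℝ := fun x => ∑ z, ω z * ∏ j, q z (x j) with hQ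
  have hR0 : ∀ x, 0 < R x := fun x => prod_pos fun j _ => hr0 _
  have hRsum : ∑ x, R x = 1 := by rw [hR, sum_prod_eq_pow, hr.2, one_pow]
  have hQsum : ∑ x, Q x = 1 := by
    simp only [hQ]
    rw [sum_comm]
    simp only [← mul_sum, sum_prod_eq_pow, (hq _).2, one_pow, mul_one, hω.2]
  have hlhs : ∑ z, ω z * iidSum (q z) f - iidSum r f = ∑ x, (Q x - R x) * f x := by
    simp only [iidSum, hQ, hR, sub_mul, sum_sub_distrib, mul_sum, sum_mul]
    rw [sum_comm]
    congr 1
    exact sum_congr rfl fun x _ => sum_congr rfl fun z _ => by ring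
  have hQQ : ∑ x, Q x ^ 2 / R x =
      ∑ z, ω z * ∑ z', ω z' * (∑ x, q z x * q z' x / r x) ^ s := by
    simp only [← sum_prod_eq_pow, mul_sum]
    simp only [hQ, sq, sum_mul_sum, sum_div]
    rw [sum_comm]
    refine sum_congr rfl fun z _ => ?_
    rw [sum_comm]
    refine sum_congr rfl fun z' _ => sum_congr rfl fun x _ => ?_
    rw [prod_div_distrib, prod_mul_distrib, hR]
    ring
  have hchi : ∑ x, (Q x - R x) ^ 2 / R x = ∑ x, Q x ^ 2 / R x - 1 := by
    have : ∀ x, (Q x - R x) ^ 2 / R x = Q x ^ 2 / R x - 2 * Q x + R x := fun x => by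
      have := (hR0 x).ne'
      field_simp
      ring
    simp only [this, sum_add_distrib, sum_sub_distrib, ← mul_sum, hRsum, hQsum]
    ring
  rw [hlhs, ← hQQ, ← hchi]
  refine (sum_sq_le_sum_mul_sum_of_sq_le_mul univ (f := fun x => (Q x - R x) ^ 2 / R x)
    (g := fun x => R x * f x ^ 2) (fun x _ => div_nonneg (sq_nonneg _) (hR0 x).le)
    (fun x _ => mul_nonneg (hR0 x).le (sq_nonneg _)) fun x _ => le_of_eq ?_).trans ?_
  · have := (hR0 x).ne'
    field_simp
  · refine mul_le_mul_of_nonneg_left ?_ (sum_nonneg fun x _ => div_nonneg (sq_nonneg _) (hR0 x).le)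
    calc ∑ x, R x * f x ^ 2 ≤ ∑ x, R x * M ^ 2 := sum_le_sum fun x _ =>
          mul_le_mul_of_nonneg_left (sq_le_sq' (abs_le.1 (hf x)).1 (abs_le.1 (hf x)).2) (hR0 x).le
      _ = M ^ 2 := by rw [← sum_mul, hRsum, one_mul]

theorem sum_mul_self_div_eq_one_add {q r : X → ℝ} (hq : q ∈ stdSimplex ℝ X)
    (hr : r ∈ stdSimplex ℝ X) (hr0 : ∀ x, 0 < r x) :
    ∑ x, q x * q x / r x = 1 + ∑ x, (q x - r x) ^ 2 / r x := by
  have : ∀ x, q x * q x / r x = (q x - r x) ^ 2 / r x + 2 * q x - r x := fun x => by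
    have := (hr0 x).ne'
    field_simp
    ring
  simp only [this, sum_add_distrib, sum_sub_distrib, ← mul_sum, hq.2, hr.2]
  ring

theorem exp_sub_one_le_two_mul {y : ℝ} (h0 : 0 ≤ y) (h1 : y ≤ 1) : Real.exp y - 1 ≤ 2 * y := by
  have := Real.abs_exp_sub_one_le (x := y) (by rwa [abs_of_nonneg h0])
  rw [abs_of_nonneg h0] at this
  exact (le_abs_self _).trans this

theorem sq_iidSum_sub_iidSum_le {q r : X → ℝ} (hq : q ∈ stdSimplex ℝ X) (hr : r ∈ stdSimplex ℝ X)
    (hr0 : ∀ x, 0 < r x) {f : (Fin s → X) → ℝ} {M v : ℝ} (hf : ∀ x, |f x| ≤ M)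
    (hv : ∑ x, (q x - r x) ^ 2 / r x ≤ v) :
    (iidSum q f - iidSum r f) ^ 2 ≤ (Real.exp (s * v) - 1) * M ^ 2 := by
  have h := sq_sum_iidSum_sub_iidSum_le (Z := Unit) (ω := fun _ => 1) ⟨by simp, by simp⟩
    (q := fun _ => q) (fun _ => hq) hr hr0 hf
  simp only [univ_unique, sum_singleton, one_mul, sum_mul_self_div_eq_one_add hq hr hr0] at h
  refine h.trans (mul_le_mul_of_nonneg_right (sub_le_sub_right ?_ 1) (sq_nonneg _))
  rw [Real.exp_nat_mul]
  refine pow_le_pow_left₀ (add_nonneg zero_le_one (sum_nonneg fun x _ =>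
    div_nonneg (sq_nonneg _) (hr0 x).le)) ?_ s
  linarith [Real.add_one_le_exp v]

/-- The `χ²` bound with the exponential linearised when `s * v ≤ 1`; otherwise the right side
exceeds the trivial bound `2 * M`. -/
theorem abs_iidSum_sub_iidSum_le_sqrt {q r : X → ℝ} (hq : q ∈ stdSimplex ℝ X)
    (hr : r ∈ stdSimplex ℝ X) (hr0 : ∀ x, 0 < r x) {f : (Fin s → X) → ℝ} {M v : ℝ} (hM : 0 ≤ M)
    (hf : ∀ x, |f x| ≤ M) (hv : ∑ x, (q x - r x) ^ 2 / r x ≤ v) :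
    |iidSum q f - iidSum r f| ≤ M * (2 * √(s * v)) := by
  have hv0 : 0 ≤ v := (sum_nonneg fun x _ => div_nonneg (sq_nonneg _) (hr0 x).le).trans hv
  have hy : 0 ≤ s * v := by positivity
  rcases le_total (s * v) 1 with h1 | h1
  · refine abs_le_of_sq_le_sq ((sq_iidSum_sub_iidSum_le hq hr hr0 hf hv).trans ?_) (by positivity)
    rw [mul_pow, mul_pow, Real.sq_sqrt hy]
    have := mul_le_mul_of_nonneg_right (exp_sub_one_le_two_mul hy h1) (sq_nonneg M)
    nlinarith [mul_nonneg hy (sq_nonneg M)]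
  · have h2 : 1 ≤ √(s * v) := Real.one_le_sqrt.2 h1
    have h3 := abs_le.1 (abs_iidSum_le hq hf)
    have h4 := abs_le.1 (abs_iidSum_le hr hf)
    rw [abs_le]
    constructor <;> nlinarith

end IidSum

/-! ### Centred mixtures against Lipschitz functions. -/

section Blocks

variable {X : Type} {s : ℕ}
variable [Fintype X]

/-- This is the second-order gain. Switching one sample from `r` to `q b` integrates against the
remaining samples the function `H b`, of size at most `L * l`. If those samples came from `r`, the
average over `b` would vanish by `havg`; only the discrepancy `τ` between `q b` and `r` on them
survives. -/
theorem abs_sum_iidSum_sub_iidSum_le {B : Type} [Fintype B] {ω : B → ℝ} (hω : ω ∈ stdSimplex ℝ B)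
    {r : X → ℝ} (hr : r ∈ stdSimplex ℝ X) {q : B → X → ℝ} (hq : ∀ b, q b ∈ stdSimplex ℝ X)
    (havg : ∀ x, ∑ b, ω b * (q b x - r x) = 0) {l L τ : ℝ} (hl0 : 0 ≤ l) (hL : 0 ≤ L)
    (hl : ∀ b, ∑ x, |q b x - r x| ≤ l)
    (hτ : ∀ k ≤ s, ∀ (b : B) (h : (Fin k → X) → ℝ) (M : ℝ), 0 ≤ M → (∀ x, |h x| ≤ M) →
      |iidSum (q b) h - iidSum r h| ≤ M * τ)
    {f : (Fin s → X) → ℝ} (hf : HamLip L f) :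
    |∑ b, ω b * iidSum (q b) f - iidSum r f| ≤ s * (L * l * τ) := by
  induction s with
  | zero => simp [iidSum_length_zero, ← sum_mul, hω.2]
  | succ s ih =>
    set F : X → (Fin s → X) → ℝ := fun a x => f (Fin.cons a x) with hF
    set H : B → (Fin s → X) → ℝ := fun b x => ∑ a, (q b a - r a) * F a x with hH
    have hHbound : ∀ b x, |H b x| ≤ L * l := fun b x =>
      (abs_sum_mul_le_of_sum_eq_zero (by rw [sum_sub_distrib, (hq b).2, hr.2, sub_self])
        fun a a' => hf.abs_cons_sub_cons x a a').trans (mul_le_mul_of_nonneg_left (hl b) hL)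
    -- The first-order term: with the other samples drawn from `r`, it depends on `b` only linearly
    -- through `q b - r`.
    have hzero : ∑ b, ω b * ∑ a, (q b a - r a) * iidSum r (F a) = 0 := by
      simp only [mul_sum]
      rw [sum_comm]
      refine sum_eq_zero fun a _ => ?_
      simp only [← mul_assoc]
      rw [← sum_mul, havg, zero_mul]
    have key : ∑ b, ω b * iidSum (q b) f - iidSum r f =
        ∑ b, ω b * (iidSum (q b) (H b) - iidSum r (H b)) +
        ∑ a, r a * (∑ b, ω b * iidSum (q b) (F a) - iidSum r (F a)) := by
      have hcomm : ∑ a, r a * ∑ b, ω b * iidSum (q b) (F a) =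
          ∑ b, ω b * ∑ a, r a * iidSum (q b) (F a) := by
        simp only [mul_sum]
        rw [sum_comm]
        exact sum_congr rfl fun _ _ => sum_congr rfl fun _ _ => by ring
      simp only [hH, iidSum_finset_sum, mul_sub, sum_sub_distrib, hcomm]
      have := hzero
      simp only [iidSum_succ _ f, mul_sub, sub_mul, sum_sub_distrib, hF] at this ⊢
      linarith
    have h1 := abs_sum_mul_le_of_mem_stdSimplex hω fun b =>
      hτ s (Nat.le_succ s) b (H b) (L * l) (mul_nonneg hL hl0) (hHbound b)
    have h2 := abs_sum_mul_le_of_mem_stdSimplex hr fun a =>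
      ih (fun k hk => hτ k (hk.trans (Nat.le_succ s))) (hf.cons a)
    rw [key]
    refine (abs_add_le _ _).trans ((add_le_add h1 h2).trans (le_of_eq ?_))
    push_cast
    ring

/-- Supplies `τ`: a function bounded by `M` is `2 * M`-Lipschitz, which gives the first entry of the
minimum, and `χ²` gives the second. -/
theorem abs_iidSum_sub_iidSum_le_min {q r : X → ℝ} (hq : q ∈ stdSimplex ℝ X)
    (hr : r ∈ stdSimplex ℝ X) (hr0 : ∀ x, 0 < r x) {l v : ℝ} (hl : ∑ x, |q x - r x| ≤ l)
    (hv : ∑ x, (q x - r x) ^ 2 / r x ≤ v) {k : ℕ} (hk : k ≤ s) {h : (Fin k → X) → ℝ} {M : ℝ}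
    (hM : 0 ≤ M) (hh : ∀ x, |h x| ≤ M) :
    |iidSum q h - iidSum r h| ≤ M * min (2 * (s * l)) (2 * √(s * v)) := by
  have hl0 : 0 ≤ l := (sum_nonneg fun x _ => abs_nonneg _).trans hl
  have hv0 : 0 ≤ v := (sum_nonneg fun x _ => div_nonneg (sq_nonneg _) (hr0 x).le).trans hv
  have hks : (k : ℝ) ≤ s := by exact_mod_cast hk
  rw [mul_min_of_nonneg _ _ hM]
  refine le_min ?_ ?_
  · refine (abs_iidSum_sub_iidSum_le_of_hamLip hq hr (hamLip_of_abs_le hh)).trans ?_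
    calc (k : ℝ) * (2 * M * ∑ a, |q a - r a|) ≤ s * (2 * M * l) := by gcongr
      _ = M * (2 * (s * l)) := by ring
  · refine (abs_iidSum_sub_iidSum_le_sqrt hq hr hr0 hM hh hv).trans ?_
    gcongr

/-- Independent perturbations, each centred and supported in its own block of the domain. -/
theorem abs_iidSum_iidSum_sub_iidSum_le {B : Type} [Fintype B] {ω : B → ℝ}
    (hω : ω ∈ stdSimplex ℝ B) {κ l v L : ℝ} (hl0 : 0 ≤ l) (hL : 0 ≤ L) {f : (Fin s → X) → ℝ}
    (hf : HamLip L f) {m : ℕ} {u : Fin m → B → X → ℝ} (hsum : ∀ g b, ∑ x, u g b x = 0)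
    (havg : ∀ g x, ∑ b, ω b * u g b x = 0) (hpos : ∀ g b x, 0 < κ + u g b x)
    (hdisj : ∀ g g', g ≠ g' → ∀ b b' x, u g b x ≠ 0 → u g' b' x = 0)
    (hl : ∀ g b, ∑ x, |u g b x| ≤ l) (hv : ∀ g b, ∑ x, u g b x ^ 2 / κ ≤ v)
    {r : X → ℝ} (hr : r ∈ stdSimplex ℝ X) (hr0 : ∀ x, 0 < r x)
    (hbase : ∀ g b x, u g b x ≠ 0 → r x = κ) :
    |iidSum ω (fun z : Fin m → B => iidSum (fun x => r x + ∑ g, u g (z g) x) f) - iidSum r f| ≤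
      m * (s * (L * l * min (2 * (s * l)) (2 * √(s * v)))) := by
  induction m generalizing r with
  | zero => simp [iidSum_length_zero]
  | succ m ih =>
    set T := s * (L * l * min (2 * (s * l)) (2 * √(s * v))) with hT
    set q : B → X → ℝ := fun b x => r x + u 0 b x with hq
    have hq0 : ∀ b x, 0 < q b x := fun b x => by
      by_cases h : u 0 b x = 0
      · simpa [hq, h] using hr0 x
      · simpa only [hq, hbase 0 b x h] using hpos 0 b x
    have hqmem : ∀ b, q b ∈ stdSimplex ℝ X := fun b =>
      ⟨fun x => (hq0 b x).le, by simp only [hq, sum_add_distrib, hr.2, hsum, add_zero]⟩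
    have hqr : ∀ b x, q b x - r x = u 0 b x := fun b x => by simp [hq]
    have hstep : |∑ b, ω b * iidSum (q b) f - iidSum r f| ≤ T := by
      refine abs_sum_iidSum_sub_iidSum_le hω hr hqmem (by simpa only [hqr] using havg 0) hl0 hL
        (by simpa only [hqr] using hl 0) (fun k hk b h M hM hh => ?_) hf
      refine abs_iidSum_sub_iidSum_le_min (hqmem b) hr hr0 (by simpa only [hqr] using hl 0 b)
        ?_ hk hM hh
      refine le_trans (le_of_eq (sum_congr rfl fun x _ => ?_)) (hv 0 b)
      rw [hqr]
      by_cases h : u 0 b x = 0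
      · simp [h]
      · rw [hbase 0 b x h]
    -- Once block `0` is fixed, the base becomes `q b`, which is why `r` varies in the induction. By
    -- disjointness the new base still equals `κ` on the later blocks.
    have hrec : ∀ b, |iidSum ω (fun z : Fin m → B =>
        iidSum (fun x => q b x + ∑ g, u (Fin.succ g) (z g) x) f) - iidSum (q b) f| ≤ m * T :=
      fun b => ih (u := fun g => u g.succ) (fun g => hsum g.succ) (fun g => havg g.succ)
        (fun g => hpos g.succ) (fun g g' h => hdisj g.succ g'.succ fun h' =>
          h (Fin.succ_injective m h')) (fun g => hl g.succ) (fun g => hv g.succ) (hqmem b) (hq0 b) fun g b' x hx => by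
          simp only [hq]
          rw [hdisj g.succ 0 (Fin.succ_ne_zero g) b' b x hx, add_zero, hbase g.succ b' x hx]
    have hsplit : iidSum ω (fun z : Fin (m + 1) → B =>
        iidSum (fun x => r x + ∑ g, u g (z g) x) f) - iidSum r f =
        ∑ b, ω b * (iidSum ω (fun z : Fin m → B =>
          iidSum (fun x => q b x + ∑ g, u (Fin.succ g) (z g) x) f) - iidSum (q b) f) +
        (∑ b, ω b * iidSum (q b) f - iidSum r f) := by
      rw [iidSum_succ]
      simp only [Fin.sum_univ_succ, Fin.cons_zero, Fin.cons_succ, mul_sub, sum_sub_distrib, hq,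
        add_assoc]
      ring
    rw [hsplit]
    refine (abs_add_le _ _).trans
      ((add_le_add (abs_sum_mul_le_of_mem_stdSimplex hω hrec) hstep).trans (le_of_eq ?_))
    push_cast
    ring

/-! ### Distributions at a prescribed distance from uniform. -/

theorem card_filter_val_lt {n k : ℕ} (hk : k ≤ n) :
    #(univ.filter fun x : Fin n => (x : ℕ) < k) = k := by
  rw [Fin.card_filter_val_lt, min_eq_right hk]

theorem sum_ite_val_lt {n k : ℕ} (hk : k ≤ n) (a b : ℝ) :
    ∑ x : Fin n, (if (x : ℕ) < k then a else b) = k * a + (n - k) * b := by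
  have h : ∀ x : Fin n, (if (x : ℕ) < k then a else b) = b + if (x : ℕ) < k then a - b else 0 :=
    fun x => by split_ifs <;> ring
  simp only [h, sum_add_distrib, ← sum_filter, sum_const, card_filter_val_lt hk, nsmul_eq_mul,
    card_univ, Fintype.card_fin]
  ring

/-- Mass `η` is taken evenly from the last `n - k` elements and spread evenly over the first `k`;
the bound on `η` is nonnegativity. -/
theorem exists_distr_of_block {n k : ℕ} (hk : 0 < k) (hkn : k < n) {η : ℝ} (h0 : 0 ≤ η)
    (h1 : η ≤ 1 - k / n) :
    ∃ p ∈ stdSimplex ℝ (Fin n), ∑ x, |p x - 1 / n| = 2 * η ∧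
      ∑ x, (p x - 1 / n) ^ 2 = η ^ 2 * (1 / k + 1 / (n - k)) := by
  have hk' : (0 : ℝ) < k := by exact_mod_cast hk
  have hn' : (0 : ℝ) < n := by exact_mod_cast hk.trans hkn
  have hnk : (0 : ℝ) < n - k := sub_pos.2 (by exact_mod_cast hkn)
  have hη : η / (n - k) ≤ 1 / n := by
    rw [div_le_div_iff₀ hnk hn']
    have := mul_le_mul_of_nonneg_right h1 hn'.le
    rw [sub_mul, div_mul_cancel₀ _ hn'.ne'] at this
    linarith
  have hd : ∀ x : Fin n, 1 / (n : ℝ) + (if (x : ℕ) < k then η / k else -(η / (n - k))) - 1 / n =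
      if (x : ℕ) < k then η / k else -(η / (n - k)) := fun x => by ring
  refine ⟨fun x => 1 / n + if (x : ℕ) < k then η / k else -(η / (n - k)), ⟨fun x => ?_, ?_⟩, ?_, ?_⟩
  · dsimp only
    split_ifs
    · positivity
    · linarith
  · rw [sum_add_distrib, sum_ite_val_lt hkn.le]
    simp only [sum_const, card_univ, Fintype.card_fin, nsmul_eq_mul]
    field_simp
    ring
  · simp only [hd, apply_ite abs, abs_neg, abs_of_nonneg (div_nonneg h0 hk'.le),
      abs_of_nonneg (div_nonneg h0 hnk.le)]
    rw [sum_ite_val_lt hkn.le]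
    field_simp
    ring
  · simp only [hd, ite_pow]
    rw [sum_ite_val_lt hkn.le]
    field_simp

/-- For every `η`, a distribution at distance exactly `η` from uniform, whose `χ²` divergence is
`O(η²)` unless `η` is close to one. -/
theorem exists_distr_tvDist_eq {n : ℕ} (hn : 2 ≤ n) {η : ℝ} (h0 : 0 ≤ η)
    (h1 : η ≤ 1 - 1 / (n : ℝ)) :
    ∃ p ∈ stdSimplex ℝ (Fin n), ∑ x, |p x - 1 / n| = 2 * η ∧
      (η ≤ 3 / 4 → ∑ x, (p x - 1 / n) ^ 2 ≤ 9 * η ^ 2 / n) := by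
  have hn' : (2 : ℝ) ≤ n := by exact_mod_cast hn
  -- A block of `n / 4` elements keeps `χ²` small but reaches only distance `3/4`. A single element
  -- reaches every `η`, and its `χ²` bound is needed only for `n ≤ 3`.
  by_cases h : 4 ≤ n ∧ η ≤ 3 / 4
  · obtain ⟨h4, hη⟩ := h
    have hk0 : 0 < n / 4 := by omega
    have hk1 : ((n / 4 : ℕ) : ℝ) ≤ n / 4 := Nat.cast_div_le
    have hk2 : (n : ℝ) ≤ 7 * (n / 4 : ℕ) := by exact_mod_cast (by omega : n ≤ 7 * (n / 4))
    obtain ⟨p, hp, hp1, hp2⟩ := exists_distr_of_block (n := n) hk0 (by omega) h0 (by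
      have : ((n / 4 : ℕ) : ℝ) / n ≤ 1 / 4 := by
        rw [div_le_iff₀ (by linarith)]
        linarith
      linarith)
    refine ⟨p, hp, hp1, fun _ => ?_⟩
    have hk0' : (0 : ℝ) < (n / 4 : ℕ) := by exact_mod_cast hk0
    have e1 : 1 / ((n / 4 : ℕ) : ℝ) ≤ 7 / n := by
      rw [div_le_div_iff₀ hk0' (by linarith)]
      linarith
    have e2 : 1 / ((n : ℝ) - (n / 4 : ℕ)) ≤ 2 / n := by
      rw [div_le_div_iff₀ (by linarith) (by linarith)]
      linarith
    rw [hp2]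
    calc η ^ 2 * (1 / ((n / 4 : ℕ) : ℝ) + 1 / (n - (n / 4 : ℕ))) ≤ η ^ 2 * (7 / n + 2 / n) := by
          gcongr
      _ = 9 * η ^ 2 / n := by ring
  · obtain ⟨p, hp, hp1, hp2⟩ := exists_distr_of_block (n := n) one_pos (by omega) h0
      (by simpa using h1)
    refine ⟨p, hp, hp1, fun hη => ?_⟩
    have h4 : (n : ℝ) ≤ 3 := by
      exact_mod_cast (by by_contra hc; exact h ⟨by omega, hη⟩ : n ≤ 3)
    have e : 1 / ((1 : ℕ) : ℝ) + 1 / ((n : ℝ) - (1 : ℕ)) ≤ 9 / n := by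
      push_cast
      rw [div_add_div _ _ one_ne_zero (by linarith), div_le_div_iff₀ (by linarith) (by linarith)]
      nlinarith
    rw [hp2]
    calc _ ≤ η ^ 2 * (9 / n) := by gcongr
      _ = 9 * η ^ 2 / n := by ring

end Blocks

/-! ### The random perturbation of uniform on blocks of four. -/

section Perturbation

variable {s : ℕ}

theorem iidSum_prod {B : Type} [Fintype B] (p : B → ℝ) (φ : Fin s → B → ℝ) :
    iidSum p (fun z => ∏ j, φ j (z j)) = ∏ j, ∑ b, p b * φ j b := by
  classical
  simp only [iidSum, ← prod_mul_distrib]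
  rw [prod_univ_sum, Fintype.piFinset_univ]

/-- The profile of a perturbation inside a block of four elements. -/
noncomputable def blockWeight (b a : Fin 4) : ℝ := if a = b then 3 else -1

/-- The perturbation that moves mass towards the element `b` in the block number `g`. -/
noncomputable def blockPert (n : ℕ) (t : ℝ) (g : Fin (n / 4)) (b : Fin 4) (x : Fin n) : ℝ :=
  if (x : ℕ) / 4 = g then t / n * blockWeight b ⟨x % 4, Nat.mod_lt _ (by norm_num)⟩ else 0

theorem blockPert_eq_zero {n : ℕ} {t : ℝ} {g : Fin (n / 4)} {x : Fin n} (h : (x : ℕ) / 4 ≠ g)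
    (b : Fin 4) : blockPert n t g b x = 0 :=
  if_neg h

theorem sum_blockWeight (b : Fin 4) : ∑ a, blockWeight b a = 0 := by
  fin_cases b <;> simp [Fin.sum_univ_four, blockWeight] <;> norm_num

theorem sum_blockWeight_left (a : Fin 4) : ∑ b, blockWeight b a = 0 := by
  fin_cases a <;> simp [Fin.sum_univ_four, blockWeight] <;> norm_num

theorem sum_abs_blockWeight (b : Fin 4) : ∑ a, |blockWeight b a| = 6 := by
  fin_cases b <;> simp [Fin.sum_univ_four, blockWeight] <;> norm_num

theorem sum_blockWeight_mul (b b' : Fin 4) :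
    ∑ a, blockWeight b a * blockWeight b' a = if b = b' then 12 else -4 := by
  fin_cases b <;> fin_cases b' <;> simp [Fin.sum_univ_four, blockWeight] <;> norm_num

variable {n : ℕ} {t : ℝ}

theorem sum_ite_block (g : Fin (n / 4)) (φ : Fin 4 → ℝ) :
    ∑ x : Fin n, (if (x : ℕ) / 4 = g then φ ⟨x % 4, Nat.mod_lt _ (by norm_num)⟩ else 0) =
      ∑ a, φ a := by
  rw [← sum_filter]
  refine sum_bij' (fun x _ => ⟨x % 4, Nat.mod_lt _ (by norm_num)⟩)
    (fun a _ => ⟨4 * g + a, by have := g.2; have := a.2; omega⟩) ?_ ?_ ?_ ?_ ?_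
  · exact fun _ _ => mem_univ _
  · intro a _
    simp only [mem_filter, mem_univ, true_and]
    omega
  · intro x hx
    simp only [mem_filter, mem_univ, true_and] at hx
    ext
    simp only
    omega
  · intro a _
    ext
    simp only
    omega
  · exact fun _ _ => rfl

theorem sum_comp_blockPert (F : ℝ → ℝ) (hF : F 0 = 0) (g : Fin (n / 4)) (b : Fin 4) :
    ∑ x, F (blockPert n t g b x) = ∑ a, F (t / n * blockWeight b a) := by
  simp only [blockPert, apply_ite F, hF]
  exact sum_ite_block g fun a => F (t / n * blockWeight b a)

theorem sum_blockPert (g : Fin (n / 4)) (b : Fin 4) : ∑ x, blockPert n t g b x = 0 := by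
  rw [sum_comp_blockPert (fun y => y) rfl g b, ← mul_sum, sum_blockWeight, mul_zero]

theorem sum_abs_blockPert (ht : 0 ≤ t) (g : Fin (n / 4)) (b : Fin 4) :
    ∑ x, |blockPert n t g b x| = 6 * t / n := by
  rw [sum_comp_blockPert (fun y => |y|) abs_zero g b]
  simp only [abs_mul, ← mul_sum, sum_abs_blockWeight]
  rw [abs_of_nonneg (by positivity)]
  ring

theorem sum_blockPert_mul (g : Fin (n / 4)) (b b' : Fin 4) :
    ∑ x, blockPert n t g b x * blockPert n t g b' x =
      (t / n) ^ 2 * if b = b' then 12 else -4 := by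
  rw [← sum_blockWeight_mul, mul_sum, ← sum_ite_block g]
  refine sum_congr rfl fun x _ => ?_
  simp only [blockPert]
  split_ifs <;> ring

theorem sum_weight_mul_blockPert (g : Fin (n / 4)) (x : Fin n) :
    ∑ b, 1 / 4 * blockPert n t g b x = 0 := by
  simp only [blockPert]
  split_ifs
  · rw [← mul_sum, ← mul_sum, sum_blockWeight_left]
    ring
  · simp

theorem blockPert_eq_zero_of_ne {g g' : Fin (n / 4)} (h : g ≠ g') (b b' : Fin 4) (x : Fin n)
    (hx : blockPert n t g b x ≠ 0) : blockPert n t g' b' x = 0 := by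
  simp only [blockPert] at *
  split_ifs with h'
  · rw [if_neg (fun h'' => h (Fin.ext (h''.symm.trans h')))] at hx
    exact absurd rfl hx
  · rfl

theorem neg_le_blockPert (ht : 0 ≤ t) (g : Fin (n / 4)) (b : Fin 4) (x : Fin n) :
    -(t / n) ≤ blockPert n t g b x := by
  have : 0 ≤ t / n := by positivity
  simp only [blockPert, blockWeight]
  split_ifs <;> linarith

/-- Blocks are disjoint, so at each `x` at most one summand is nonzero. The last `n % 4` elements
belong to no block. -/
theorem comp_sum_blockPert (F : ℝ → ℝ → ℝ) (hF : F 0 0 = 0) (z z' : Fin (n / 4) → Fin 4)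
    (x : Fin n) :
    F (∑ g, blockPert n t g (z g) x) (∑ g, blockPert n t g (z' g) x) =
      ∑ g, F (blockPert n t g (z g) x) (blockPert n t g (z' g) x) := by
  by_cases h : (x : ℕ) / 4 < n / 4
  · have h0 : ∀ g : Fin (n / 4), g ≠ ⟨(x : ℕ) / 4, h⟩ → ∀ b, blockPert n t g b x = 0 :=
      fun g hg b => blockPert_eq_zero (fun h' => hg (Fin.ext h'.symm)) b
    rw [Fintype.sum_eq_single _ fun g hg => h0 g hg (z g),
      Fintype.sum_eq_single _ fun g hg => h0 g hg (z' g),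
      Fintype.sum_eq_single ⟨(x : ℕ) / 4, h⟩ fun g hg => by rw [h0 g hg, h0 g hg, hF]]
  · have h0 : ∀ (g : Fin (n / 4)) b, blockPert n t g b x = 0 :=
      fun g b => blockPert_eq_zero (fun h' => h (h' ▸ g.2)) b
    simp [h0, hF]

/-- The uniform distribution, perturbed in every block of four elements. -/
noncomputable def perturbed (n : ℕ) (t : ℝ) (z : Fin (n / 4) → Fin 4) (x : Fin n) : ℝ :=
  1 / n + ∑ g, blockPert n t g (z g) x

theorem uniform_mem_stdSimplex (hn : 0 < n) : (fun _ => 1 / (n : ℝ)) ∈ stdSimplex ℝ (Fin n) := by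
  have : (n : ℝ) ≠ 0 := by exact_mod_cast hn.ne'
  exact ⟨fun _ => by positivity, by simp [this]⟩

theorem sum_sum_blockPert (z : Fin (n / 4) → Fin 4) : ∑ x, ∑ g, blockPert n t g (z g) x = 0 := by
  rw [sum_comm]
  exact sum_eq_zero fun g _ => sum_blockPert g _

theorem perturbed_mem_stdSimplex (hn : 0 < n) (h0 : 0 ≤ t) (h1 : t ≤ 1) (z : Fin (n / 4) → Fin 4) :
    perturbed n t z ∈ stdSimplex ℝ (Fin n) := by
  refine ⟨fun x => ?_, ?_⟩
  · have hn' : 0 < (n : ℝ) := by exact_mod_cast hn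
    have ht : t / n ≤ 1 / n := by gcongr
    have ht0 : 0 ≤ t / n := by positivity
    have : -(t / n) ≤ ∑ g, blockPert n t g (z g) x := by
      by_cases h : (x : ℕ) / 4 < n / 4
      · rw [Fintype.sum_eq_single ⟨(x : ℕ) / 4, h⟩ fun g hg =>
          blockPert_eq_zero (fun h' => hg (Fin.ext h'.symm)) _]
        exact neg_le_blockPert h0 _ _ _
      · rw [sum_eq_zero fun g _ => blockPert_eq_zero (fun h' => h (h' ▸ g.2)) _]
        linarith
    simp only [perturbed]
    linarith
  · simp only [perturbed, sum_add_distrib, sum_sum_blockPert, add_zero]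
    exact (uniform_mem_stdSimplex hn).2

theorem sum_abs_perturbed_sub (ht : 0 ≤ t) (z : Fin (n / 4) → Fin 4) :
    ∑ x, |perturbed n t z x - 1 / n| = (n / 4 : ℕ) * (6 * t / n) := by
  have h : ∀ x, |perturbed n t z x - 1 / n| = ∑ g, |blockPert n t g (z g) x| := fun x => by
    rw [perturbed, add_sub_cancel_left]
    exact comp_sum_blockPert (fun y _ => |y|) abs_zero z z x
  simp only [h]
  rw [sum_comm]
  simp only [sum_abs_blockPert ht, sum_const, card_univ, Fintype.card_fin, nsmul_eq_mul]

theorem sum_perturbed_mul_div (hn : 0 < n) (z z' : Fin (n / 4) → Fin 4) :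
    ∑ x, perturbed n t z x * perturbed n t z' x / (1 / n) =
      1 + t ^ 2 / n * ∑ g, if z g = z' g then 12 else -4 := by
  have hn' : (n : ℝ) ≠ 0 := by exact_mod_cast hn.ne'
  have h : ∀ x, perturbed n t z x * perturbed n t z' x / (1 / n) =
      1 / n + ∑ g, blockPert n t g (z g) x + ∑ g, blockPert n t g (z' g) x +
        n * ∑ g, blockPert n t g (z g) x * blockPert n t g (z' g) x := fun x => by
    rw [← comp_sum_blockPert (fun y y' => y * y') (zero_mul 0) z z' x, perturbed, perturbed]
    field_simp
    ring
  simp only [h, sum_add_distrib, sum_sum_blockPert, ← mul_sum]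
  rw [sum_comm, (uniform_mem_stdSimplex hn).2]
  simp only [sum_blockPert_mul, ← mul_sum]
  field_simp
  ring

theorem fourth_weight_mem_stdSimplex : (fun _ => 1 / 4 : Fin 4 → ℝ) ∈ stdSimplex ℝ (Fin 4) :=
  ⟨fun _ => by norm_num, by simp⟩

/-- The exponent has mean zero and mean square `(144 + 3 * 16) / 4 * y ^ 2 = 48 * y ^ 2`, and `exp u
≤ 1 + u + u ^ 2` for `|u| ≤ 1`. -/
theorem sum_exp_block_le {y : ℝ} (h0 : 0 ≤ y) (h1 : 12 * y ≤ 1) (a : Fin 4) :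
    ∑ b, 1 / 4 * Real.exp (y * if a = b then 12 else -4) ≤ Real.exp (48 * y ^ 2) := by
  have e1 := (abs_le.1 (Real.abs_exp_sub_one_sub_id_le (x := y * 12)
    (by rw [abs_of_nonneg (by linarith)]; linarith))).2
  have e2 := (abs_le.1 (Real.abs_exp_sub_one_sub_id_le (x := y * -4)
    (by rw [abs_le]; constructor <;> linarith))).2
  have e3 := Real.add_one_le_exp (48 * y ^ 2)
  fin_cases a <;> simp [Fin.sum_univ_four] at e1 e2 ⊢ <;> linarith

/-- After `(1 + a) ^ s ≤ exp (s * a)` the expectation factors over the independent blocks. -/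
theorem iidSum_pow_le (hn : 0 < n) (h0 : 0 ≤ t) (h1 : t ≤ 1) (hst : 12 * (s * (t ^ 2 / n)) ≤ 1)
    (z : Fin (n / 4) → Fin 4) :
    iidSum (fun _ => 1 / 4) (fun z' : Fin (n / 4) → Fin 4 =>
      (∑ x, perturbed n t z x * perturbed n t z' x / (1 / n)) ^ s) ≤
      Real.exp (12 * (s ^ 2 * t ^ 4 / n)) := by
  have hn' : (0 : ℝ) < n := by exact_mod_cast hn
  set y : ℝ := s * (t ^ 2 / n) with hy
  have hpow : ∀ z' : Fin (n / 4) → Fin 4,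
      (∑ x, perturbed n t z x * perturbed n t z' x / (1 / n)) ^ s ≤
        ∏ g, Real.exp (y * if z g = z' g then 12 else -4) := fun z' => by
    have hnn : 0 ≤ ∑ x, perturbed n t z x * perturbed n t z' x / (1 / n) :=
      sum_nonneg fun x _ => div_nonneg (mul_nonneg ((perturbed_mem_stdSimplex hn h0 h1 z).1 x)
        ((perturbed_mem_stdSimplex hn h0 h1 z').1 x)) (by positivity)
    rw [← Real.exp_sum, ← mul_sum, hy, mul_assoc, Real.exp_nat_mul]
    refine pow_le_pow_left₀ hnn ?_ s
    rw [sum_perturbed_mul_div hn]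
    linarith [Real.add_one_le_exp (t ^ 2 / n * ∑ g, if z g = z' g then (12 : ℝ) else -4)]
  refine (iidSum_mono fourth_weight_mem_stdSimplex hpow).trans ?_
  rw [iidSum_prod (fun _ => 1 / 4) fun g b => Real.exp (y * if z g = b then 12 else -4)]
  refine (prod_le_prod (fun g _ => sum_nonneg fun b _ => by positivity)
    fun g _ => sum_exp_block_le (by positivity) hst (z g)).trans ?_
  rw [prod_const, card_univ, Fintype.card_fin, ← Real.exp_nat_mul]
  refine Real.exp_le_exp.2 ?_
  have hm : ((n / 4 : ℕ) : ℝ) ≤ n / 4 := Nat.cast_div_le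
  calc ((n / 4 : ℕ) : ℝ) * (48 * y ^ 2) ≤ n / 4 * (48 * y ^ 2) := by gcongr
    _ = 12 * (s ^ 2 * t ^ 4 / n) := by
      rw [hy]
      field_simp
      ring

theorem half_le_of_le_exp_sub_one {D y : ℝ} (hD : D ≤ 2) (h0 : 0 ≤ y) (h : D ≤ Real.exp y - 1) :
    D / 2 ≤ y := by
  rcases le_total y 1 with h1 | h1
  · linarith [exp_sub_one_le_two_mul h0 h1]
  · linarith

/-- Second moment method when `s * t ^ 2 / n` is small; otherwise `n` is already at most `12 * (s *
t ^ 2)`. The constant comes from `12 * 800 / 9 ≤ 34 ^ 2`. -/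
theorem le_sq_of_mixture_gap (hn : 0 < n) (h0 : 0 ≤ t) (h1 : t ≤ 1) {f : (Fin s → Fin n) → ℝ}
    (hf : ∀ x, |f x| ≤ 1)
    (hgap : 3 / 20 ≤ |iidSum (fun _ => 1 / 4) (fun z => iidSum (perturbed n t z) f) -
      iidSum (fun _ => 1 / (n : ℝ)) f|) :
    (n : ℝ) ≤ (34 * (s * t ^ 2)) ^ 2 := by
  have hn' : (1 : ℝ) ≤ n := by exact_mod_cast hn
  by_cases hst : 12 * (s * (t ^ 2 / n)) ≤ 1
  · set ω : (Fin (n / 4) → Fin 4) → ℝ := fun z => ∏ j, (fun _ => 1 / 4 : Fin 4 → ℝ) (z j) with hω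
    have hωmem : ω ∈ stdSimplex ℝ (Fin (n / 4) → Fin 4) :=
      ⟨fun z => prod_nonneg fun _ _ => by norm_num, by
        simp only [hω]
        rw [sum_prod_eq_pow (fun _ => 1 / 4 : Fin 4 → ℝ), fourth_weight_mem_stdSimplex.2, one_pow]⟩
    have h := sq_sum_iidSum_sub_iidSum_le hωmem (perturbed_mem_stdSimplex hn h0 h1)
      (uniform_mem_stdSimplex hn) (fun _ => by positivity) hf
    have hbound : ∑ z, ω z * ∑ z', ω z' * (∑ x, perturbed n t z x * perturbed n t z' x / (1 / n)) ^ s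
        ≤ Real.exp (12 * (s ^ 2 * t ^ 4 / n)) := by
      calc _ ≤ ∑ z, ω z * Real.exp (12 * (s ^ 2 * t ^ 4 / n)) :=
            sum_le_sum fun z _ => mul_le_mul_of_nonneg_left (iidSum_pow_le hn h0 h1 hst z)
              (hωmem.1 z)
        _ = _ := by rw [← sum_mul, hωmem.2, one_mul]
    have hsq : (3 / 20) ^ 2 ≤ (∑ z, ω z * iidSum (perturbed n t z) f -
        iidSum (fun _ => 1 / (n : ℝ)) f) ^ 2 := by
      rw [← sq_abs (∑ z, ω z * _ - _)]
      exact pow_le_pow_left₀ (by norm_num) hgap 2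
    have := half_le_of_le_exp_sub_one (D := (3 / 20) ^ 2) (by norm_num)
      (by positivity : (0 : ℝ) ≤ 12 * (s ^ 2 * t ^ 4 / n)) (by linarith)
    rw [← mul_div_assoc, le_div_iff₀ (by linarith)] at this
    nlinarith [sq_nonneg (s * t ^ 2)]
  · have h2 : (n : ℝ) ≤ 12 * (s * t ^ 2) := by
      have := (not_le.1 hst).le
      rwa [← mul_div_assoc, ← mul_div_assoc, le_div_iff₀ (by linarith), one_mul] at this
    nlinarith

/-- At most `n / 4` blocks, each of `ℓ₁` size `6 * t / n` and `χ²` size `12 * t ^ 2 / n`. -/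
theorem mixture_gap_le (hn : 0 < n) (h0 : 0 ≤ t) (h1 : t < 1) {L : ℝ} (hL : 0 ≤ L)
    {f : (Fin s → Fin n) → ℝ} (hf : HamLip L f) :
    |iidSum (fun _ => 1 / 4) (fun z => iidSum (perturbed n t z) f) -
      iidSum (fun _ => 1 / (n : ℝ)) f| ≤
      s * (L * (3 / 2 * t) * min (2 * (s * (6 * t / n))) (2 * √(s * (12 * t ^ 2 / n)))) := by
  have hn' : (0 : ℝ) < n := by exact_mod_cast hn
  have hlt : t / n < 1 / n := by gcongr
  have h := abs_iidSum_iidSum_sub_iidSum_le fourth_weight_mem_stdSimplex (κ := 1 / n)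
    (l := 6 * t / n) (v := 12 * t ^ 2 / n) (by positivity) hL hf (u := blockPert n t)
    sum_blockPert sum_weight_mul_blockPert
    (fun g b x => by linarith [neg_le_blockPert h0 g b x])
    (fun g g' hg b b' x => blockPert_eq_zero_of_ne hg b b' x)
    (fun g b => (sum_abs_blockPert h0 g b).le)
    (fun g b => by
      rw [← sum_div]
      simp only [sq (blockPert n t g b _), sum_blockPert_mul, if_true]
      refine le_of_eq ?_
      field_simp)
    (uniform_mem_stdSimplex hn) (fun _ => by positivity) (fun _ _ _ _ => rfl)
  refine h.trans ?_
  have hm : ((n / 4 : ℕ) : ℝ) ≤ n / 4 := Nat.cast_div_le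
  set μ := min (2 * (s * (6 * t / n))) (2 * √(s * (12 * t ^ 2 / n))) with hμ
  have hμ0 : 0 ≤ μ := by positivity
  calc _ ≤ (n / 4 : ℝ) * (s * (L * (6 * t / n) * μ)) := by gcongr
    _ = s * (L * (3 / 2 * t) * μ) := by
      field_simp
      ring

end Perturbation

/-! ### From separating functions to the two rates. -/

section Rates

variable {n s : ℕ}

theorem inv_sq_le_of_chiSq_gap (hn : 0 < n) {q : Fin n → ℝ} (hq : q ∈ stdSimplex ℝ (Fin n))
    {f : (Fin s → Fin n) → ℝ} (hf : ∀ x, |f x| ≤ 1) {g d : ℝ} (hd0 : 0 ≤ d) (hd1 : d ≤ 1)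
    (hv : ∑ x, (q x - 1 / n) ^ 2 ≤ 9 * g ^ 2 / n)
    (hgap : d ≤ |iidSum q f - iidSum (fun _ => 1 / (n : ℝ)) f|) :
    d ^ 2 / 2 ≤ s * (9 * g ^ 2) := by
  have hn' : (0 : ℝ) < n := by exact_mod_cast hn
  have hv' : ∑ x, (q x - 1 / n) ^ 2 / (1 / (n : ℝ)) ≤ 9 * g ^ 2 := by
    rw [← sum_div, div_le_iff₀ (by positivity)]
    exact hv.trans_eq (by ring)
  have h := sq_iidSum_sub_iidSum_le hq (uniform_mem_stdSimplex hn) (fun _ => by positivity) hf hv'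
  rw [← sq_abs] at h
  have h2 := pow_le_pow_left₀ hd0 hgap 2
  exact half_le_of_le_exp_sub_one (by nlinarith) (by positivity) (by linarith)

/-- A test function that separates uniform from a distribution at distance `g`. -/
theorem adviceRate_le_of_gap (hn : 2 ≤ n) {q : Fin n → ℝ} (hq : q ∈ stdSimplex ℝ (Fin n))
    {g ξ : ℝ} (hg : 0 < g) (hg1 : g ≤ 1) (hξ : 0 < ξ) (hq1 : ∑ x, |q x - 1 / n| = 2 * g)
    (hq2 : g ≤ 1 / 4 → ∑ x, (q x - 1 / n) ^ 2 ≤ 9 * g ^ 2 / n)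
    {f : (Fin s → Fin n) → ℝ} (hf : ∀ x, |f x| ≤ 1) (hf1 : HamLip 1 f)
    (hfξ : ξ ≤ 1 → HamLip (2 * ξ) f)
    (hgap : 1 / 4 ≤ |iidSum q f - iidSum (fun _ => 1 / (n : ℝ)) f|) :
    adviceRate g ξ ≤ 600 * s := by
  have hn0 : 0 < n := by omega
  have hU := uniform_mem_stdSimplex hn0
  have hs1 : (1 : ℝ) ≤ s := by
    have h := hgap.trans (abs_iidSum_sub_iidSum_le_of_hamLip hq hU hf1)
    have : s ≠ 0 := by
      rintro rfl
      norm_num at h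
    exact_mod_cast Nat.one_le_iff_ne_zero.2 this
  have h1 : 1 / g ^ 2 ≤ 300 * s := by
    rw [div_le_iff₀ (by positivity)]
    rcases le_total g (1 / 4) with h | h
    · have := inv_sq_le_of_chiSq_gap hn0 hq hf (by norm_num) (by norm_num) (hq2 h) hgap
      nlinarith
    · have : 1 / 16 ≤ g ^ 2 := by nlinarith
      nlinarith
  have h2 : 1 / (ξ * g) ≤ 300 * s := by
    rcases le_total ξ 1 with h | h
    · have := hgap.trans (abs_iidSum_sub_iidSum_le_of_hamLip hq hU (hfξ h))
      rw [hq1] at this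
      rw [div_le_iff₀ (by positivity)]
      nlinarith
    · refine le_trans ?_ h1
      gcongr
      nlinarith
  rw [adviceRate]
  linarith

/-- For `ξ ≥ 1` the three privacy terms are dominated by `√n / ε ^ 2`, so they need separate bounds
only for `ξ ≤ 1`. -/
theorem identityRate_le {ε ξ S : ℝ} (hn : 0 < n) (hε : 0 < ε) (hε1 : ε < 1) (hξ : 0 < ξ)
    (hS : 0 ≤ S) (h1 : √(n : ℝ) ≤ 20000 * S * ε ^ 2) (h2 : ξ ≤ 1 → 1 ≤ 60 * S * (ε * ξ))
    (h3 : ξ ≤ 1 → (n : ℝ) ≤ 10 ^ 9 * S ^ 3 * (ε ^ 4 * ξ ^ 2))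
    (h4 : ξ ≤ 1 → (n : ℝ) ≤ 10 ^ 6 * S ^ 2 * (ε ^ 2 * ξ)) :
    identityRate n ε ξ ≤ 80000 * S := by
  have hn1 : (1 : ℝ) ≤ n := by exact_mod_cast hn
  have hsn : 1 ≤ √(n : ℝ) := Real.one_le_sqrt.2 hn1
  have hsn2 : √(n : ℝ) ^ 2 = n := Real.sq_sqrt (by linarith)
  have a1 : √(n : ℝ) / ε ^ 2 ≤ 20000 * S := by rwa [div_le_iff₀ (by positivity)]
  have hε2 : ε ^ 2 ≤ ε := by nlinarith
  have a2 : 1 / (ε * ξ) ≤ 20000 * S := by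
    rcases le_total ξ 1 with h | h
    · rw [div_le_iff₀ (by positivity)]
      have := h2 h
      nlinarith [mul_nonneg hS (mul_pos hε hξ).le]
    · refine le_trans ?_ a1
      gcongr
      nlinarith
  have a4 : √(n : ℝ) / (ε * √ξ) ≤ 20000 * S := by
    rcases le_total ξ 1 with h | h
    · rw [div_le_iff₀ (by positivity)]
      refine Real.sqrt_le_iff.2 ⟨by positivity, (h4 h).trans ?_⟩
      rw [mul_pow, mul_pow, mul_pow, Real.sq_sqrt hξ.le]
      have : 0 ≤ S ^ 2 * (ε ^ 2 * ξ) := by positivity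
      nlinarith
    · refine le_trans ?_ a1
      have : 1 ≤ √ξ := Real.one_le_sqrt.2 h
      gcongr
      nlinarith
  have a3 : (n : ℝ) ^ (1 / 3 : ℝ) / (ε ^ (4 / 3 : ℝ) * ξ ^ (2 / 3 : ℝ)) ≤ 20000 * S := by
    have hcube : ((n : ℝ) ^ (1 / 3 : ℝ) / (ε ^ (4 / 3 : ℝ) * ξ ^ (2 / 3 : ℝ))) ^ 3 =
        n / (ε ^ 4 * ξ ^ 2) := by
      rw [div_pow, mul_pow, ← Real.rpow_mul_natCast (by positivity),
        ← Real.rpow_mul_natCast hε.le, ← Real.rpow_mul_natCast hξ.le,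
        ← Real.rpow_natCast ε 4, ← Real.rpow_natCast ξ 2]
      norm_num
    refine le_of_pow_le_pow_left₀ (n := 3) (by norm_num) (by positivity) ?_
    rw [hcube]
    rcases le_total ξ 1 with h | h
    · rw [div_le_iff₀ (by positivity)]
      refine (h3 h).trans ?_
      rw [mul_pow]
      have : 0 ≤ S ^ 3 * (ε ^ 4 * ξ ^ 2) := by positivity
      nlinarith
    · have hA1 : 1 ≤ √(n : ℝ) / ε ^ 2 := by
        rw [le_div_iff₀ (by positivity)]
        nlinarith
      calc (n : ℝ) / (ε ^ 4 * ξ ^ 2) ≤ n / (ε ^ 4 * 1) := by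
            gcongr
            nlinarith
        _ = (√(n : ℝ) / ε ^ 2) ^ 2 := by
            rw [div_pow, hsn2]
            ring
        _ ≤ (√(n : ℝ) / ε ^ 2) ^ 3 := pow_le_pow_right₀ hA1 (by norm_num)
        _ ≤ (20000 * S) ^ 3 := by gcongr
  rw [identityRate]
  linarith

/-- A test function that separates uniform from every distribution that is `ε`-far from it. -/
theorem identityRate_le_of_gap (hn : 2 ≤ n) {ε ξ : ℝ} (hε : 0 < ε) (hε1 : ε < 1 / 2) (hξ : 0 < ξ)
    {f : (Fin s → Fin n) → ℝ} (hf : ∀ x, |f x| ≤ 1) (hfξ : ξ ≤ 1 → HamLip (2 * ξ) f)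
    (hU : 7 / 20 ≤ iidSum (fun _ => 1 / (n : ℝ)) f)
    (hfar : ∀ p ∈ stdSimplex ℝ (Fin n), 2 * ε < ∑ x, |p x - 1 / n| → iidSum p f ≤ 1 / 5) :
    identityRate n ε ξ ≤ 80000 * s := by
  have hn0 : 0 < n := by omega
  have hn' : (2 : ℝ) ≤ n := by exact_mod_cast hn
  have hUm := uniform_mem_stdSimplex hn0
  have hs0 : (0 : ℝ) ≤ s := by positivity
  -- The distance `min (2 * ε) (1 / 2)` exceeds `ε`, is attained for every `n ≥ 2`, and lies in the
  -- range of the `χ²` estimate.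
  obtain ⟨p, hp, hp1, hp2⟩ := exists_distr_tvDist_eq hn (η := min (2 * ε) (1 / 2)) (by positivity)
    (by
      have : 1 / (n : ℝ) ≤ 1 / 2 := by gcongr
      exact (min_le_right _ _).trans (by linarith))
  set τ := min (2 * ε) (1 / 2) with hτ
  have hτ0 : 0 < τ := by positivity
  have hτ1 : τ ≤ 2 * ε := min_le_left _ _
  have hτε : ε < τ := lt_min (by linarith) hε1
  have hgap : 3 / 20 ≤ |iidSum p f - iidSum (fun _ => 1 / (n : ℝ)) f| := by
    rw [abs_sub_comm]
    exact le_trans (by linarith [hfar p hp (by rw [hp1]; linarith)]) (le_abs_self _)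
  have hsingle : ξ ≤ 1 → 1 ≤ 60 * s * (ε * ξ) := fun h => by
    have := hgap.trans (abs_iidSum_sub_iidSum_le_of_hamLip hp hUm (hfξ h))
    rw [hp1] at this
    have h' : s * (2 * ξ * (2 * τ)) ≤ s * (2 * ξ * (2 * (2 * ε))) := by gcongr
    nlinarith
  have hchi : 1 ≤ 3300 * s * ε ^ 2 := by
    have := inv_sq_le_of_chiSq_gap hn0 hp hf (by norm_num) (by norm_num)
      (hp2 ((min_le_right _ _).trans (by norm_num))) hgap
    have h' : s * (9 * τ ^ 2) ≤ s * (9 * (2 * ε) ^ 2) := by gcongr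
    nlinarith
  -- For bounded `n` the single alternative `p` already yields every term, as powers of `hchi` and
  -- `hsingle`.
  by_cases hlarge : n < 30
  · have hn36 : (n : ℝ) ≤ 36 := by exact_mod_cast (by omega : n ≤ 36)
    refine identityRate_le hn0 hε (by linarith) hξ hs0 ?_ hsingle (fun h => ?_) fun h => ?_
    · have : √(n : ℝ) ≤ 6 := Real.sqrt_le_iff.2 ⟨by norm_num, by linarith⟩
      linarith
    · have h2 := one_le_pow₀ (hsingle h) (n := 2)
      have h3 := mul_le_mul hchi h2 zero_le_one (by positivity)
      have : 0 ≤ (s : ℝ) ^ 3 * (ε ^ 4 * ξ ^ 2) := by positivity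
      nlinarith
    · have h2 := one_le_pow₀ (hsingle h) (n := 2)
      have h3 : (s : ℝ) ^ 2 * (ε ^ 2 * ξ ^ 2) ≤ s ^ 2 * (ε ^ 2 * ξ) := by
        gcongr
        nlinarith
      have : 0 ≤ (s : ℝ) ^ 2 * (ε ^ 2 * ξ) := by positivity
      nlinarith
  · have hn30 : (30 : ℝ) ≤ n := by exact_mod_cast not_lt.1 hlarge
    have hnp : (0 : ℝ) < n := by linarith
    -- The perturbed distance is about `3 / 4 * t = 9 / 8 * ε`; the factor `9 / 8` absorbs the
    -- elements outside the blocks once `n > 27`. Blocks of four allow `t < 1` for all `ε < 1 / 2`.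
    set t := 3 / 2 * ε with ht
    have ht0 : 0 ≤ t := by positivity
    have ht1 : t < 1 := by linarith
    have hm : (n : ℝ) ≤ 4 * (n / 4 : ℕ) + 3 := by
      exact_mod_cast (by omega : n ≤ 4 * (n / 4) + 3)
    have hmix : 3 / 20 ≤ |iidSum (fun _ => 1 / 4) (fun z => iidSum (perturbed n t z) f) -
        iidSum (fun _ => 1 / (n : ℝ)) f| := by
      have : iidSum (fun _ => 1 / 4) (fun z => iidSum (perturbed n t z) f) ≤ 1 / 5 := by
        rw [← iidSum_const (s := n / 4) fourth_weight_mem_stdSimplex (1 / 5)]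
        refine iidSum_mono fourth_weight_mem_stdSimplex fun z =>
          hfar _ (perturbed_mem_stdSimplex hn0 ht0 ht1.le z) ?_
        rw [sum_abs_perturbed_sub ht0, ← mul_div_assoc, lt_div_iff₀ hnp]
        nlinarith
      rw [abs_sub_comm]
      exact le_trans (by linarith) (le_abs_self _)
    have hlip := fun h : ξ ≤ 1 =>
      hmix.trans (mixture_gap_le hn0 ht0 ht1 (by positivity) (hfξ h))
    refine identityRate_le hn0 hε (by linarith) hξ hs0 ?_ hsingle (fun h => ?_) fun h => ?_
    · have h1 := le_sq_of_mixture_gap hn0 ht0 ht1.le hf hmix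
      refine (Real.sqrt_le_iff.2 ⟨by positivity, h1⟩).trans ?_
      rw [ht]
      nlinarith [mul_nonneg hs0 (sq_nonneg ε)]
    -- Squaring the `χ²` branch leaves `s ^ 3`, hence the cube-root term.
    · have h1 : 3 / 20 ≤ s * (2 * ξ * (3 / 2 * t) * (2 * √(s * (12 * t ^ 2 / n)))) :=
        (hlip h).trans (by gcongr; exact min_le_right _ _)
      have h2 := pow_le_pow_left₀ (by norm_num) h1 2
      have h3 : (s * (2 * ξ * (3 / 2 * t) * (2 * √(s * (12 * t ^ 2 / n))))) ^ 2 =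
          432 * s ^ 3 * ξ ^ 2 * t ^ 4 / n := by
        simp only [mul_pow]
        rw [Real.sq_sqrt (by positivity)]
        ring
      rw [h3, le_div_iff₀ hnp, ht] at h2
      have : 0 ≤ (s : ℝ) ^ 3 * (ε ^ 4 * ξ ^ 2) := by positivity
      nlinarith
    -- The Lipschitz branch is quadratic in `s`, hence the term with `√ξ`.
    · have h1 : 3 / 20 ≤ s * (2 * ξ * (3 / 2 * t) * (2 * (s * (6 * t / n)))) :=
        (hlip h).trans (by gcongr; exact min_le_left _ _)
      have h3 : s * (2 * ξ * (3 / 2 * t) * (2 * (s * (6 * t / n)))) =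
          36 * s ^ 2 * ξ * t ^ 2 / n := by ring
      rw [h3, le_div_iff₀ hnp, ht] at h1
      have : 0 ≤ (s : ℝ) ^ 2 * (ε ^ 2 * ξ) := by positivity
      nlinarith

/-! ### Application to private testers. -/

theorem answerProb_eq_iidSum (A : Algorithm n s) (p : Distr (Fin n)) (a : Answer) :
    answerProb A p a = iidSum p (fun x => A x a) := rfl

theorem abs_algorithm_le_one (A : Algorithm n s) (a : Answer) (x : Fin s → Fin n) :
    |A x a| ≤ 1 := by
  have h0 : ∀ b, 0 ≤ A x b := (A x).2.1
  have h1 : ∑ b, A x b = 1 := (A x).2.2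
  rw [abs_of_nonneg (h0 a), ← h1]
  exact single_le_sum (fun b _ => h0 b) (mem_univ a)

theorem hamLip_one (A : Algorithm n s) (a : Answer) : HamLip 1 (fun x => A x a) := fun x j b => by
  have h0 : ∀ y, 0 ≤ A y a := fun y => (A y).2.1 a
  have h1 : ∀ y, A y a ≤ 1 := fun y => (abs_le.1 (abs_algorithm_le_one A a y)).2
  rw [abs_le]
  constructor <;> linarith [h0 x, h1 x, h0 (update x j b), h1 (update x j b)]

theorem IsDP.hamLip {A : Algorithm n s} {ξ : ℝ} (hA : IsDP ξ A) (hξ : 0 < ξ) (hξ1 : ξ ≤ 1)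
    (a : Answer) : HamLip (2 * ξ) (fun x => A x a) := fun x j b => by
  by_cases hb : b = x j
  · simp only [hb, update_eq_self, sub_self, abs_zero]
    positivity
  · have hd : hammingDist (update x j b) x = 1 := by
      rw [hammingDist, card_eq_one]
      refine ⟨j, ?_⟩
      ext i
      by_cases hi : i = j
      · subst hi
        simp [hb]
      · simp [hi]
    have hd' : hammingDist x (update x j b) = 1 := by rw [hammingDist_comm, hd]
    have e1 := hA _ _ hd {a}
    have e2 := hA _ _ hd' {a}
    simp only [sum_singleton] at e1 e2
    have h1 : ∀ y, A y a ≤ 1 := fun y => (abs_le.1 (abs_algorithm_le_one A a y)).2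
    have hexp := exp_sub_one_le_two_mul hξ.le hξ1
    have hexp0 := Real.add_one_le_exp ξ
    rw [abs_le]
    constructor <;> nlinarith [h1 x, h1 (update x j b)]

theorem coe_uniform (n : ℕ) [NeZero n] : ⇑(uniform n) = fun _ => 1 / (n : ℝ) := by
  ext x
  change (stdSimplex.barycenter : stdSimplex ℝ (Fin n)).val x = _
  rw [stdSimplex.barycenter_apply, Fintype.card_fin, one_div]

theorem tvDist_uniform_left [NeZero n] (p : Distr (Fin n)) :
    tvDist (uniform n) p = 1 / 2 * ∑ x, |p x - 1 / n| := by
  rw [tvDist]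
  simp only [coe_uniform, abs_sub_comm]

theorem IsPrivateAugmentedIdentityTester.identityRate_le [NeZero n] {ξ ε α : ℝ}
    {phat : Distr (Fin n)} {A : Algorithm n s} (hn : 2 ≤ n) (hε : 0 < ε) (hε1 : ε < 1 / 2)
    (hξ : 0 < ξ) (hA : IsPrivateAugmentedIdentityTester ξ ε α (1 / 5) (uniform n) phat A)
    (hU : 7 / 20 ≤ answerProb A (uniform n) Answer.accept) :
    identityRate n ε ξ ≤ 80000 * s := by
  refine identityRate_le_of_gap hn hε hε1 hξ (abs_algorithm_le_one A Answer.accept)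
    (fun h => hA.isDP.hamLip hξ h _) (by rwa [answerProb_eq_iidSum, coe_uniform] at hU)
    fun p hp hfar => hA.accept_le ⟨p, hp⟩ fun q hq => ?_
  rw [Set.mem_singleton_iff.1 hq, tvDist]
  simp only [coe_uniform]
  change ε < 1 / 2 * ∑ x, |p x - 1 / n|
  linarith

theorem IsPrivateAugmentedIdentityTester.adviceRate_le [NeZero n] {ξ ε α η : ℝ}
    {phat : Distr (Fin n)} {A : Algorithm n s} (hn : 2 ≤ n) (hη1 : η ≤ 1) (hα : 0 ≤ α)
    (hα1 : α < 1 / 2) (hαη : α < η) (hξ : 0 < ξ) (hphat : ∑ x, |phat x - 1 / n| = 2 * η)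
    (hphat2 : η ≤ 3 / 4 → ∑ x, (phat x - 1 / n) ^ 2 ≤ 9 * η ^ 2 / n)
    (hA : IsPrivateAugmentedIdentityTester ξ ε α (1 / 5) (uniform n) phat A)
    (hU : 9 / 20 ≤ answerProb A (uniform n) Answer.bot) :
    adviceRate (η - α) ξ ≤ 600 * s := by
  have hη0 : 0 < η := hα.trans_lt hαη
  -- With this weight, `q` is at distance exactly `α` from `phat` and `η - α` from uniform.
  set θ := (η - α) / η with hθ
  have hθ0 : 0 ≤ θ := div_nonneg (by linarith) hη0.le
  have hθ1 : θ ≤ 1 := (div_le_one hη0).2 (by linarith)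
  have hθη : θ * η = η - α := div_mul_cancel₀ _ hη0.ne'
  have hUm := uniform_mem_stdSimplex (n := n) (by omega)
  have hphatm : ⇑phat ∈ stdSimplex ℝ (Fin n) := phat.2
  set q : Fin n → ℝ := fun x => (1 - θ) * (1 / n) + θ * phat x with hq
  have hqm : q ∈ stdSimplex ℝ (Fin n) :=
    ⟨fun x => add_nonneg (mul_nonneg (by linarith) (hUm.1 x)) (mul_nonneg hθ0 (hphatm.1 x)), by
      simp only [hq, sum_add_distrib, ← mul_sum, hphatm.2, hUm.2]
      ring⟩
  have hqU : ∀ x, q x - 1 / n = θ * (phat x - 1 / n) := fun x => by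
    simp only [hq]
    ring
  have hqp : ∀ x, q x - phat x = -((1 - θ) * (phat x - 1 / n)) := fun x => by
    simp only [hq]
    ring
  have hbot : iidSum q (fun x => A x Answer.bot) ≤ 1 / 5 := by
    refine hA.bot_le ⟨q, hqm⟩ ?_
    change 1 / 2 * ∑ x, |q x - phat x| ≤ α
    simp only [hqp, abs_neg, abs_mul, ← mul_sum, hphat, abs_of_nonneg (sub_nonneg.2 hθ1)]
    linarith
  refine adviceRate_le_of_gap hn hqm (by linarith) (by linarith) hξ ?_ (fun h => ?_)
    (abs_algorithm_le_one A Answer.bot) (hamLip_one A _) (fun h => hA.isDP.hamLip hξ h _) ?_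
  · simp only [hqU, abs_mul, ← mul_sum, hphat, abs_of_nonneg hθ0]
    linarith
  · simp only [hqU, mul_pow, ← mul_sum]
    calc θ ^ 2 * ∑ x, (phat x - 1 / n) ^ 2 ≤ θ ^ 2 * (9 * η ^ 2 / n) := by
          gcongr
          -- Here `η - α ≤ 1 / 4` and `α < 1 / 2` force `η ≤ 3 / 4`.
          exact hphat2 (by linarith)
      _ = 9 * (η - α) ^ 2 / n := by
          rw [← hθη]
          ring
  · rw [answerProb_eq_iidSum, coe_uniform] at hU
    rw [abs_sub_comm]
    exact le_trans (by linarith) (le_abs_self _)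

/-- A tester for `ε = 0` is one for every positive `ε`, and the identity rate is unbounded as `ε`
tends to `0`. -/
theorem not_isPrivateAugmentedIdentityTester_zero [NeZero n] {ξ α : ℝ}
    {phat : Distr (Fin n)} {A : Algorithm n s} (hn : 2 ≤ n) (hξ : 0 < ξ)
    (hU : 7 / 20 ≤ answerProb A (uniform n) Answer.accept) :
    ¬ IsPrivateAugmentedIdentityTester ξ 0 α (1 / 5) (uniform n) phat A := fun hA => by
  -- This makes `√n / ε ^ 2` exceed `80000 * s`; the `3` keeps `ε < 1 / 2` when `s = 0`.
  set ε : ℝ := 1 / (80000 * s + 3) with hε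
  have hs : (0 : ℝ) ≤ 80000 * s := by positivity
  have hε0 : 0 < ε := by positivity
  have hε1 : ε < 1 / 2 := by
    rw [hε, div_lt_div_iff₀ (by positivity) (by norm_num)]
    linarith
  have h := IsPrivateAugmentedIdentityTester.identityRate_le hn hε0 hε1 hξ
    ⟨hA.isDP, hA.reject_le, fun p hp => hA.accept_le p fun q hq => hε0.trans (hp q hq),
      hA.bot_le⟩ hU
  have h1 : √(n : ℝ) / ε ^ 2 ≤ identityRate n ε ξ := by
    have e1 : 0 ≤ (n : ℝ) ^ (1 / 3 : ℝ) / (ε ^ (4 / 3 : ℝ) * ξ ^ (2 / 3 : ℝ)) := by positivity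
    have e2 : 0 ≤ √(n : ℝ) / (ε * √ξ) := by positivity
    have e3 : 0 ≤ 1 / (ε * ξ) := by positivity
    rw [identityRate]
    linarith
  have h2 : (80000 * s + 3 : ℝ) ^ 2 ≤ √(n : ℝ) / ε ^ 2 := by
    have : 1 ≤ √(n : ℝ) := Real.one_le_sqrt.2 (by exact_mod_cast (by omega : 1 ≤ n))
    rw [hε, one_div, inv_pow, div_inv_eq_mul]
    nlinarith [sq_nonneg (80000 * s + 3 : ℝ)]
  nlinarith

end Rates

end AugTest

theorem mainTheorem2 :
    ∃ c : ℝ, 0 < c ∧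
      ∀ (n : ℕ) [NeZero n] (η : ℝ), 0 ≤ η → η ≤ 1 - 1 / (n : ℝ) →
        ∃ phat : AugTest.Distr (Fin n),
          AugTest.tvDist (AugTest.uniform n) phat = η ∧
          ∀ ε α ξ : ℝ, 0 ≤ ε → ε < 1 / 2 → 0 ≤ α → α < 1 / 2 → 0 < ξ → α < η →
            ∀ (s : ℕ) (A : AugTest.Algorithm n s),
              AugTest.IsPrivateAugmentedIdentityTester ξ ε α (1 / 5) (AugTest.uniform n) phat A →
                c * AugTest.augmentedRate n ε α η ξ ≤ (s : ℝ) := by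
  refine ⟨1 / 80000, by norm_num, fun n _ η hη0 hη1 => ?_⟩
  have hn0 : n ≠ 0 := NeZero.ne n
  rcases (by omega : n = 1 ∨ 2 ≤ n) with rfl | hn
  -- On one point the claim is vacuous, since `0 ≤ α < η = 0` is impossible.
  · have hη : η = 0 := le_antisymm (by simpa using hη1) hη0
    refine ⟨AugTest.uniform 1, by simp [AugTest.tvDist, hη], fun ε α ξ _ _ hα _ _ hαη => ?_⟩
    linarith
  · obtain ⟨p, hp, hp1, hp2⟩ := AugTest.exists_distr_tvDist_eq hn hη0 hη1
    have hηle : η ≤ 1 := hη1.trans (sub_le_self _ (by positivity))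
    refine ⟨⟨p, hp⟩, ?_, fun ε α ξ hε0 hε1 hα0 hα1 hξ hαη s A hA => ?_⟩
    · rw [AugTest.tvDist_uniform_left]
      change 1 / 2 * ∑ x, |p x - 1 / n| = η
      rw [hp1]
      ring
    have hs : (0 : ℝ) ≤ s := by positivity
    -- The threshold leaves `1 - 1/5 - 9/20 = 7/20` for acceptance, so the gaps to `1/5` are `1/4`
    -- and `3/20`.
    by_cases hbot : 9 / 20 ≤ AugTest.answerProb A (AugTest.uniform n) AugTest.Answer.bot
    · have h := hA.adviceRate_le hn hηle hα0 hα1 hαη hξ hp1 hp2 hbot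
      have h' : AugTest.augmentedRate n ε α η ξ ≤ AugTest.adviceRate (η - α) ξ := by
        rw [AugTest.augmentedRate]
        split_ifs
        · exact le_rfl
        · exact min_le_left _ _
      linarith
    · have hacc : 7 / 20 ≤ AugTest.answerProb A (AugTest.uniform n) AugTest.Answer.accept := by
        have hrej := hA.reject_le _ rfl
        have hsum : ∑ a, AugTest.answerProb A (AugTest.uniform n) a = 1 := by
          have h := AugTest.iidSum_const (s := s) (AugTest.uniform n).2 1
          rw [← h]
          simp only [AugTest.answerProb_eq_iidSum, AugTest.iidSum]
          rw [Finset.sum_comm]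
          refine Finset.sum_congr rfl fun x _ => ?_
          rw [← Finset.mul_sum]
          exact congrArg _ (A x).2.2
        have huniv : (Finset.univ : Finset AugTest.Answer) =
            {AugTest.Answer.accept, AugTest.Answer.reject, AugTest.Answer.bot} := rfl
        rw [huniv, Finset.sum_insert (by simp), Finset.sum_insert (by simp),
          Finset.sum_singleton] at hsum
        linarith [not_le.1 hbot]
      rcases hε0.eq_or_lt with rfl | hε
      · exact absurd hA (AugTest.not_isPrivateAugmentedIdentityTester_zero hn hξ hacc)
      · have h := hA.identityRate_le hn hε hε1 hξ hacc
        have h' : AugTest.augmentedRate n ε α η ξ ≤ AugTest.identityRate n ε ξ := by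
          rw [AugTest.augmentedRate, if_neg hε.ne']
          exact min_le_right _ _
        linarith
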